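/- Let $X$ be an infinite-dimensional real Banach space with closed unit ball $B(X)$, and let $$\kappa(X)=\sup_{(x_n)\subset B(X)}\ \inf_{n\neq m}\|x_n-x_m\|$$ be its Kottman constant, the supremum being over all sequences in $B(X)$. Let $c_0$ be the real Banach space of null sequences with the supremum norm. For $\alpha\in(0,1]$ and a map $f$ between metric spaces $(M,d)$ and $(Y,\rho)$ put $$\operatorname{Lip}_\alpha(f)=\sup\left\{\frac{\rho(f(x),f(y))}{d(x,y)^\alpha} : x\neq y\right\},$$ and call $f$ $\alpha$-Hölder if $\operatorname{Lip}_\alpha(f)<\infty$. Let $\lambda_\alpha(X,c_0)$ be the infimum of all real $\lambda>0$ such that for every subset $M\subseteq X$, every $\alpha$-Hölder map $f:M\to c_0$ admits an extension $F:X\to c_0$ with $\operatorname{Lip}_\alpha(F)\le\lambda\operatorname{Lip}_\alpha(f)$ (the infimum of the empty set being $\infty$). Then, for every $\alpha\in(0,1]$, $$\lambda_\alpha(X,c_0)=\kappa(X)^\alpha,$$ and the infimum defining $\lambda_\alpha(X,c_0)$ is attained. -/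

import Mathlib

open scoped NNReal ENNReal ZeroAtInfty

noncomputable section

/-- The separation of a sequence: the infimum of `‖x n - x m‖` over all pairs `n ≠ m`. -/
def seqSep {X : Type*} [NormedAddCommGroup X] (x : ℕ → X) : ℝ≥0∞ :=
  ⨅ (n : ℕ) (m : ℕ) (_ : n ≠ m), ‖x n - x m‖ₑ

/-- The Kottman constant: the supremum of the separations of all sequences in the (closed) unit
ball. -/
def kottmanConst (X : Type*) [NormedAddCommGroup X] : ℝ≥0∞ :=
  ⨆ (x : ℕ → X) (_ : ∀ n, ‖x n‖ ≤ 1), seqSep x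

/-- The number `l` is admissible in the definition of the `α`-Hölder extension constant of the
pair `(X, Y)`: it is positive, and for every subset `M` of `X` every `α`-Hölder map `f : M → Y`
admits an extension `F : X → Y` with `Lip_α(F) ≤ l * Lip_α(f)`. Here `Lip_α` is Mathlib's
`eHolderNorm α`, the least `α`-Hölder constant (infinite if there is none). -/
def IsHolderExtensionBound (α : ℝ≥0) (X Y : Type*) [MetricSpace X] [MetricSpace Y]
    (l : ℝ≥0) : Prop :=
  0 < l ∧ ∀ (M : Set X) (f : M → Y), MemHolder α f →
    ∃ F : X → Y, (∀ x : M, F x = f x) ∧ eHolderNorm α F ≤ (l : ℝ≥0∞) * eHolderNorm α f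

/-- The `α`-Hölder extension constant `λ_α(X, Y)`: the infimum of all admissible `l > 0`
(infinite if there is none). -/
def holderExtensionConst (α : ℝ≥0) (X Y : Type*) [MetricSpace X] [MetricSpace Y] : ℝ≥0∞ :=
  ⨅ (l : ℝ≥0) (_ : IsHolderExtensionBound α X Y l), (l : ℝ≥0∞)

end

/-- The real Banach space `c₀` of null sequences with the supremum norm: `ℕ` is discrete, so
vanishing at infinity means converging to zero. -/
abbrev SeqC0 : Type := C₀(ℕ, ℝ)

open Filter Topology

/-! ### The Kottman constant as a real number -/

/-! Lower bound (`kottmanConst_rpow_le_of_isHolderExtensionBound`): if `x n` lies in the unit ball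
with separation `s`, then `x n ↦ s ^ α • e_n` has Hölder constant at most 1. The `n`-th coordinate
of an extension changes by at most `l` between `x n` and `0`, while the coordinates at `0` tend to
zero, so `s ^ α ≤ l`.

Upper bound: each coordinate is extended with constant `κ ^ α * L`, staying as close to zero as
possible. The extended coordinates still form a null sequence at every `x`. Otherwise some `y n`
have an `n`-th coordinate exceeding the cone `κ ^ α * L * ‖x - y‖ ^ α` by `ε`. For fixed `k` the
`n`-th coordinate at `y k` tends to zero, so `y n` is far from `y k`; a subsequence in a ball around
`x` then beats the ratio `κ` (`eventually_le_kottmanConst_rpow_mul`). Boundedness of the `y n` needs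
`κ > 1`, the Elton-Odell theorem.

For that theorem, suppose `κ ≤ 1` and draw unit vectors along a weakly null ultrafilter, adding them
with alternating signs. If the process started at `0` left every ball of radius above 1, two
independent exit points would be nearly within the radius of each other. Coupling processes of
decreasing radii would then keep one of them inside its ball forever, a contradiction
(`exists_not_altExits`). So for some radius it does not almost surely exit, and differences of
successive draws yield a sequence bounded away from zero with bounded finite sums. James's
distortion argument for such `c₀`-like sequences gives `κ > 1` after all
(`one_lt_kottmanConst_of_norm_sum_le`). -/

theorem kottmanConst_le_two (X : Type*) [NormedAddCommGroup X] : kottmanConst X ≤ 2 := by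
  refine iSup₂_le fun x hx => ?_
  have h01 : seqSep x ≤ ‖x 0 - x 1‖ₑ :=
    iInf_le_of_le 0 (iInf_le_of_le 1 (iInf_le _ (zero_ne_one (α := ℕ))))
  refine h01.trans ?_
  have h : ‖x 0 - x 1‖ ≤ 2 := (norm_sub_le _ _).trans (by linarith [hx 0, hx 1])
  rw [← ofReal_norm]
  exact (ENNReal.ofReal_le_ofReal h).trans (by simp)

theorem kottmanConst_ne_top (X : Type*) [NormedAddCommGroup X] : kottmanConst X ≠ ∞ :=
  ((kottmanConst_le_two X).trans_lt (by simp)).ne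

theorem le_kottmanConst_mul {X : Type*} [NormedAddCommGroup X] [NormedSpace ℝ X] {r t : ℝ}
    (hr : 0 < r) (w : ℕ → X) (hw : ∀ n, ‖w n‖ ≤ r)
    (hsep : ∀ m n, m < n → t ≤ ‖w m - w n‖) : t ≤ (kottmanConst X).toReal * r := by
  have hsep' : ∀ m n, m ≠ n → t ≤ ‖w m - w n‖ := fun m n hmn => by
    rcases lt_or_gt_of_ne hmn with h | h
    · exact hsep m n h
    · rw [norm_sub_rev]; exact hsep n m h
  rw [← div_le_iff₀ hr, ← ENNReal.ofReal_le_iff_le_toReal (kottmanConst_ne_top X)]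
  refine le_trans ?_ (le_iSup₂ (f := fun (x : ℕ → X) (_ : ∀ n, ‖x n‖ ≤ 1) => seqSep x)
    (fun n => r⁻¹ • w n) fun n => ?_)
  · refine le_iInf fun n => le_iInf fun m => le_iInf fun hnm => ?_
    rw [← ofReal_norm, ← smul_sub, norm_smul, norm_inv, Real.norm_of_nonneg hr.le, div_eq_inv_mul]
    exact ENNReal.ofReal_le_ofReal (mul_le_mul_of_nonneg_left (hsep' n m hnm) (by positivity))
  · rw [norm_smul, norm_inv, Real.norm_of_nonneg hr.le, inv_mul_le_iff₀ hr, mul_one]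
    exact hw n

/-- A relation that holds along a filter in both variables successively holds along a sequence. -/
theorem Filter.exists_seq_of_eventually_eventually {β : Type*} (p : Filter β) [p.NeBot]
    {P : β → Prop} {r : β → β → Prop} (hP : ∀ᶠ a in p, P a)
    (hr : ∀ᶠ a in p, ∀ᶠ b in p, r a b) :
    ∃ u : ℕ → β, (∀ n, P (u n)) ∧ ∀ m n, m < n → r (u m) (u n) := by
  obtain ⟨u, hu, hu'⟩ := exists_seq_of_forall_finset_exists
    (fun a => P a ∧ ∀ᶠ b in p, r a b) r fun s hs => by
      have h : ∀ᶠ b in p, ∀ a ∈ s, r a b := by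
        rw [Filter.eventually_all_finset]
        exact fun a ha => (hs a ha).2
      exact ((hP.and hr).and h).exists
  exact ⟨u, fun n => (hu n).1, hu'⟩

/-- In an infinite-dimensional space there is an ultrafilter of unit vectors along which every
functional vanishes eventually. -/
theorem exists_ultrafilter_norm_eq_one_forall_dual {X : Type*} [NormedAddCommGroup X]
    [NormedSpace ℝ X] (hX : ¬ FiniteDimensional ℝ X) :
    ∃ 𝒰 : Ultrafilter X, (∀ᶠ x in (𝒰 : Filter X), ‖x‖ = 1) ∧
      ∀ f : X →L[ℝ] ℝ, ∀ᶠ x in (𝒰 : Filter X), f x = 0 := by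
  classical
  set W : Finset (X →L[ℝ] ℝ) → Set X := fun s => {x | ‖x‖ = 1 ∧ ∀ f ∈ s, f x = 0} with hW
  have hne : ∀ s, (W s).Nonempty := fun s => by
    -- Finitely many functionals on an infinite-dimensional space have a common nonzero kernel
    -- vector.
    set Φ : X →ₗ[ℝ] (s → ℝ) := LinearMap.pi fun f => (f : X →L[ℝ] ℝ).toLinearMap
    have hΦ : ¬ Function.Injective Φ := fun h => hX (FiniteDimensional.of_injective Φ h)
    rw [← LinearMap.ker_eq_bot, Submodule.eq_bot_iff] at hΦ
    push Not at hΦ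
    obtain ⟨x, hx, hx0⟩ := hΦ
    have hx' : ‖x‖ ≠ 0 := norm_ne_zero_iff.2 hx0
    refine ⟨‖x‖⁻¹ • x, ?_, fun f hf => ?_⟩
    · rw [norm_smul, norm_inv, norm_norm, inv_mul_cancel₀ hx']
    · have : f x = 0 := congrFun (LinearMap.mem_ker.1 hx) ⟨f, hf⟩
      rw [map_smul, this, smul_zero]
  have hanti : Antitone W := fun s t hst x hx => ⟨hx.1, fun f hf => hx.2 f (hst hf)⟩
  have hdir : Directed (· ≥ ·) fun s => 𝓟 (W s) := fun s t =>
    ⟨s ∪ t, principal_mono.2 (hanti Finset.subset_union_left),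
      principal_mono.2 (hanti Finset.subset_union_right)⟩
  have : (⨅ s, 𝓟 (W s)).NeBot :=
    iInf_neBot_of_directed hdir fun s => principal_neBot_iff.2 (hne s)
  have hmem : ∀ s, W s ∈ Ultrafilter.of (⨅ s, 𝓟 (W s)) := fun s =>
    (Ultrafilter.of_le (⨅ s, 𝓟 (W s))).trans (iInf_le _ s) (mem_principal_self _)
  refine ⟨Ultrafilter.of (⨅ s, 𝓟 (W s)), ?_, fun f => ?_⟩
  · filter_upwards [hmem ∅] with x hx using hx.1
  · filter_upwards [hmem {f}] with x hx using hx.2 f (Finset.mem_singleton_self f)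

/-! ### Alternating sums along an ultrafilter, stopped when they leave a ball -/

open Classical in
/-- The point at which the segment from `v` to `v + y` meets the sphere of radius `R`. -/
noncomputable def exitPoint {X : Type*} [NormedAddCommGroup X] [NormedSpace ℝ X]
    (R : ℝ) (v y : X) : X :=
  if h : ∃ t : ℝ, ‖v + t • y‖ = R then v + h.choose • y else v

/-- Start at `v` and add vectors drawn along the ultrafilter `𝒰`, with alternating signs beginning
with `σ`. The predicate says that, almost surely in the iterated sense, this process leaves the
ball of radius `R` in finitely many steps, through a point of `A`. -/
inductive AltExits {X : Type*} [NormedAddCommGroup X] [NormedSpace ℝ X] (𝒰 : Ultrafilter X)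
    (R : ℝ) (A : Set X) : ℝ → X → Prop
  | step (σ : ℝ) (v : X) (hv : ‖v‖ ≤ R) (S : Set X) (hS : S ∈ (𝒰 : Filter X))
      (hexit : ∀ x ∈ S, R < ‖v + σ • x‖ → exitPoint R v (σ • x) ∈ A)
      (hrec : ∀ x ∈ S, ‖v + σ • x‖ ≤ R → AltExits 𝒰 R A (-σ) (v + σ • x)) :
      AltExits 𝒰 R A σ v

section

variable {X : Type*} [NormedAddCommGroup X] [NormedSpace ℝ X]

theorem exitPoint_eq (R : ℝ) (v y : X) : ∃ t : ℝ, exitPoint R v y = v + t • y := by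
  unfold exitPoint
  split_ifs with h
  · exact ⟨_, rfl⟩
  · exact ⟨0, by simp⟩

theorem norm_exitPoint {R : ℝ} {v y : X} (hv : ‖v‖ ≤ R) (hy : R < ‖v + y‖) :
    ‖exitPoint R v y‖ = R := by
  have hc : Continuous fun t : ℝ => ‖v + t • y‖ := by fun_prop
  obtain ⟨t, -, ht⟩ := intermediate_value_Icc (zero_le_one (α := ℝ)) hc.continuousOn
    (show R ∈ Set.Icc ‖v + (0 : ℝ) • y‖ ‖v + (1 : ℝ) • y‖ by simpa using ⟨hv, hy.le⟩)
  have h : ∃ t : ℝ, ‖v + t • y‖ = R := ⟨t, ht⟩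
  rw [exitPoint, dif_pos h]
  exact h.choose_spec

namespace AltExits

variable {𝒰 : Ultrafilter X} {R : ℝ} {A B : Set X} {σ : ℝ} {v : X}

theorem eventually (h : AltExits 𝒰 R A σ v) :
    ∀ᶠ x in (𝒰 : Filter X), ‖v + σ • x‖ ≤ R → AltExits 𝒰 R A (-σ) (v + σ • x) := by
  cases h with
  | step _ _ hv S hS hexit hrec => exact mem_of_superset hS hrec

theorem mono (hAB : A ⊆ B) (h : AltExits 𝒰 R A σ v) : AltExits 𝒰 R B σ v := by
  induction h with
  | step σ v hv S hS hexit hrec ih =>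
    exact .step σ v hv S hS (fun x hx hR => hAB (hexit x hx hR)) ih

theorem inter (hA : AltExits 𝒰 R A σ v) (hB : AltExits 𝒰 R B σ v) :
    AltExits 𝒰 R (A ∩ B) σ v := by
  induction hA with
  | step σ v hv S hS hexit hrec ih =>
    cases hB with
    | step _ _ _ T hT hexit' hrec' =>
      exact .step σ v hv (S ∩ T) (inter_mem hS hT)
        (fun x hx hR => ⟨hexit x hx.1 hR, hexit' x hx.2 hR⟩)
        (fun x hx hR => ih x hx.1 hR (hrec' x hx.2 hR))

/-- At each step the ultrafilter decides between the two alternatives, so the exit distribution is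
itself an ultrafilter. -/
theorem or_compl (h : AltExits 𝒰 R Set.univ σ v) (A : Set X) :
    AltExits 𝒰 R A σ v ∨ AltExits 𝒰 R Aᶜ σ v := by
  induction h with
  | step σ v hv S hS hexit hrec ih =>
    set Q : Set X → X → Prop := fun C x => (R < ‖v + σ • x‖ → exitPoint R v (σ • x) ∈ C) ∧
      (‖v + σ • x‖ ≤ R → AltExits 𝒰 R C (-σ) (v + σ • x)) with hQ
    have h : ∀ᶠ x in (𝒰 : Filter X), Q A x ∨ Q Aᶜ x := by
      filter_upwards [hS] with x hx
      rcases lt_or_ge R ‖v + σ • x‖ with hR | hR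
      · by_cases hA : exitPoint R v (σ • x) ∈ A
        · exact .inl ⟨fun _ => hA, fun h => absurd h hR.not_ge⟩
        · exact .inr ⟨fun _ => hA, fun h => absurd h hR.not_ge⟩
      · rcases ih x hx hR with h | h
        · exact .inl ⟨fun h => absurd h hR.not_gt, fun _ => h⟩
        · exact .inr ⟨fun h => absurd h hR.not_gt, fun _ => h⟩
    rcases Ultrafilter.eventually_or.1 h with h | h
    · exact .inl (.step σ v hv _ h (fun x hx => hx.1) fun x hx => hx.2)
    · exact .inr (.step σ v hv _ h (fun x hx => hx.1) fun x hx => hx.2)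

theorem sphere (h : AltExits 𝒰 R Set.univ σ v) : AltExits 𝒰 R {z | ‖z‖ = R} σ v := by
  induction h with
  | step σ v hv S hS hexit hrec ih =>
    exact .step σ v hv S hS (fun x _ hR => norm_exitPoint hv hR) ih

/-- A martingale property: a given functional vanishes on almost every draw, and the exit point lies
on the segment of the last draw, so some run ends in `A` with the value of `f` unchanged. -/
theorem exists_dual_eq (h𝒰 : ∀ f : X →L[ℝ] ℝ, ∀ᶠ x in (𝒰 : Filter X), f x = 0)
    (h : AltExits 𝒰 R A σ v) (f : X →L[ℝ] ℝ) : ∃ z ∈ A, f z = f v := by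
  induction h with
  | step σ v hv S hS hexit hrec ih =>
    obtain ⟨x, hx, hfx⟩ := ((show ∀ᶠ x in (𝒰 : Filter X), x ∈ S from hS).and (h𝒰 f)).exists
    rcases lt_or_ge R ‖v + σ • x‖ with hR | hR
    · refine ⟨_, hexit x hx hR, ?_⟩
      obtain ⟨t, ht⟩ := exitPoint_eq R v (σ • x)
      simp [ht, hfx]
    · obtain ⟨z, hz, hfz⟩ := ih x hx hR
      exact ⟨z, hz, by simp [hfz, hfx]⟩

/-- A functional separating `v` from `A` would contradict its invariance along the process; thus the
start is a generalized barycentre of the exit points. -/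
theorem mem_of_convex_of_isClosed (h𝒰 : ∀ f : X →L[ℝ] ℝ, ∀ᶠ x in (𝒰 : Filter X), f x = 0)
    (h : AltExits 𝒰 R A σ v) (hA : Convex ℝ A) (hA' : IsClosed A) : v ∈ A := by
  by_contra hv
  obtain ⟨f, u, hfu, hu⟩ := geometric_hahn_banach_point_closed hA hA' hv
  obtain ⟨z, hz, hfz⟩ := h.exists_dual_eq h𝒰 f
  exact absurd (hu z hz) (by rw [hfz]; exact hfu.not_gt)

theorem nonempty (h𝒰 : ∀ f : X →L[ℝ] ℝ, ∀ᶠ x in (𝒰 : Filter X), f x = 0)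
    (h : AltExits 𝒰 R A σ v) : A.Nonempty :=
  let ⟨z, hz, _⟩ := h.exists_dual_eq h𝒰 0
  ⟨z, hz⟩

/-- The distribution of the exit point of the alternating process. -/
def exitFilter (h : AltExits 𝒰 R Set.univ σ v) : Filter X where
  sets := {A | AltExits 𝒰 R A σ v}
  univ_sets := h
  sets_of_superset := fun hA hAB => hA.mono hAB
  inter_sets := fun hA hB => hA.inter hB

theorem mem_exitFilter (h : AltExits 𝒰 R Set.univ σ v) :
    A ∈ h.exitFilter ↔ AltExits 𝒰 R A σ v := Iff.rfl

theorem exitFilter_neBot (h𝒰 : ∀ f : X →L[ℝ] ℝ, ∀ᶠ x in (𝒰 : Filter X), f x = 0)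
    (h : AltExits 𝒰 R Set.univ σ v) : h.exitFilter.NeBot := by
  refine neBot_iff.2 fun hbot => ?_
  have : AltExits 𝒰 R ∅ σ v := by
    rw [← h.mem_exitFilter, hbot]; exact mem_bot
  exact Set.not_nonempty_empty (this.nonempty h𝒰)

/-- If no bounded sequence is well separated, two independent exit points are close to each
other. -/
theorem eventually_eventually_norm_sub_le
    (h𝒰 : ∀ f : X →L[ℝ] ℝ, ∀ᶠ x in (𝒰 : Filter X), f x = 0)
    (hX : (kottmanConst X).toReal ≤ 1) (hR : 0 < R) {R' : ℝ} (hR' : R < R')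
    (h : AltExits 𝒰 R Set.univ σ v) :
    ∀ᶠ a in h.exitFilter, ∀ᶠ b in h.exitFilter, ‖a - b‖ ≤ R' := by
  have := h.exitFilter_neBot h𝒰
  rcases h.or_compl {a | ∀ᶠ b in h.exitFilter, ‖a - b‖ ≤ R'} with hA | hA
  · exact hA
  exfalso
  have hfar : ∀ᶠ a in h.exitFilter, ∀ᶠ b in h.exitFilter, R' ≤ ‖a - b‖ := by
    filter_upwards [show _ ∈ h.exitFilter from hA] with a ha
    rcases h.or_compl {b | ‖a - b‖ ≤ R'} with hb | hb
    · exact absurd hb ha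
    · filter_upwards [show _ ∈ h.exitFilter from hb] with b hb
      exact (not_le.1 (show ¬ ‖a - b‖ ≤ R' from hb)).le
  -- Successive exit points lie on the sphere of radius `R` and are `R'`-separated, which `κ ≤ 1`
  -- forbids as `R < R'`.
  obtain ⟨u, hu, hu'⟩ := Filter.exists_seq_of_eventually_eventually h.exitFilter
    (P := fun z => ‖z‖ = R) h.sphere hfar
  have := le_kottmanConst_mul hR u (fun n => (hu n).le) hu'
  nlinarith

/-- Dropping all but the first term of one of two independent exit points. -/
theorem eventually_exits_near (h𝒰1 : ∀ᶠ x in (𝒰 : Filter X), ‖x‖ = 1)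
    (h𝒰 : ∀ f : X →L[ℝ] ℝ, ∀ᶠ x in (𝒰 : Filter X), f x = 0)
    (hX : (kottmanConst X).toReal ≤ 1) (hR : 1 < R) {R' : ℝ} (hR' : R < R')
    (h : AltExits 𝒰 R Set.univ 1 0) :
    ∀ᶠ x in (𝒰 : Filter X), AltExits 𝒰 R {b | ‖x - b‖ ≤ R'} 1 0 := by
  -- The gap between `R₁` and `R'` pays for passing to the closure of the convex set below.
  obtain ⟨R₁, hR₁, hR₁'⟩ := exists_between hR'
  have hA : AltExits 𝒰 R {a | ∀ᶠ b in h.exitFilter, ‖a - b‖ ≤ R₁} 1 0 :=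
    h.eventually_eventually_norm_sub_le h𝒰 hX (by linarith) hR₁
  filter_upwards [hA.eventually, h𝒰1] with x hx hx1
  have hx' := hx (by simpa [hx1] using hR.le)
  have hconv : Convex ℝ {a | ∀ᶠ b in h.exitFilter, ‖a - b‖ ≤ R₁} := by
    intro a ha a' ha' s t hs ht hst
    show ∀ᶠ b in h.exitFilter, ‖s • a + t • a' - b‖ ≤ R₁
    filter_upwards [show ∀ᶠ b in h.exitFilter, ‖a - b‖ ≤ R₁ from ha,
      show ∀ᶠ b in h.exitFilter, ‖a' - b‖ ≤ R₁ from ha'] with b hb hb'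
    have := convex_closedBall b R₁ (mem_closedBall_iff_norm.2 hb) (mem_closedBall_iff_norm.2 hb')
      hs ht hst
    exact mem_closedBall_iff_norm.1 this
  have hmem : x ∈ closure {a | ∀ᶠ b in h.exitFilter, ‖a - b‖ ≤ R₁} := by
    simpa using (hx'.mono subset_closure).mem_of_convex_of_isClosed h𝒰 hconv.closure isClosed_closure
  obtain ⟨a, ha, hxa⟩ := Metric.mem_closure_iff.1 hmem (R' - R₁) (sub_pos.2 hR₁')
  refine (show AltExits 𝒰 R {b | ‖a - b‖ ≤ R₁} 1 0 from ha).mono fun b hb => ?_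
  have hb : ‖a - b‖ ≤ R₁ := hb
  rw [dist_eq_norm] at hxa
  show ‖x - b‖ ≤ R'
  calc ‖x - b‖ = ‖(x - a) + (a - b)‖ := by rw [sub_add_sub_cancel]
    _ ≤ ‖x - a‖ + ‖a - b‖ := norm_add_le _ _
    _ ≤ R' := by linarith

end AltExits

/-- The state `v` of the process with bound `R` is coupled to a chain of states of processes with
smaller and smaller bounds, each of which keeps the preceding one inside its ball. -/
inductive AltCoupled (𝒰 : Ultrafilter X) : ℝ → ℝ → X → Prop
  | root (R R' : ℝ) (d : X) (hR' : 1 < R') (hR : R' < R)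
      (h : AltExits 𝒰 R' {b | ‖d - b‖ ≤ R} 1 0) : AltCoupled 𝒰 R (-1) d
  | cons (R R' σ : ℝ) (d w : X) (h : AltExits 𝒰 R' {b | ‖d - b‖ ≤ R} (-σ) w)
      (hw : AltCoupled 𝒰 R' (-σ) w) : AltCoupled 𝒰 R σ (d - w)

theorem convex_norm_sub_le (d : X) (R : ℝ) : Convex ℝ {b | ‖d - b‖ ≤ R} := by
  simpa [Metric.closedBall, dist_eq_norm, norm_sub_rev d] using convex_closedBall d R

theorem isClosed_norm_sub_le {X : Type*} [NormedAddCommGroup X] (d : X) (R : ℝ) : IsClosed {b | ‖d - b‖ ≤ R} :=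
  isClosed_le (by fun_prop) continuous_const

namespace AltCoupled

variable {𝒰 : Ultrafilter X} {R σ : ℝ} {v : X}

/-- The inner process can only exit inside the ball of radius `R` about `d`, which is closed and
convex, so its current state (`0` at the root) already lies there. -/
theorem norm_le (h𝒰 : ∀ f : X →L[ℝ] ℝ, ∀ᶠ x in (𝒰 : Filter X), f x = 0)
    (h : AltCoupled 𝒰 R σ v) : ‖v‖ ≤ R := by
  cases h with
  | root _ R' _ hR' hR h =>
    have := h.mem_of_convex_of_isClosed h𝒰 (convex_norm_sub_le _ _) (isClosed_norm_sub_le _ _)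
    rwa [Set.mem_ofPred_eq, sub_zero] at this
  | cons _ R' _ d w h hw =>
    have := h.mem_of_convex_of_isClosed h𝒰 (convex_norm_sub_le _ _) (isClosed_norm_sub_le _ _)
    exact this

/-- One draw serves the whole chain: adding `σ • x` to `d - w` amounts to adding `-σ • x` to the
inner state `w`. At the root the inner state `0` moves to `x`, and a new process with a bound
strictly between 1 and `R'` is attached below it. -/
theorem eventually (h𝒰1 : ∀ᶠ x in (𝒰 : Filter X), ‖x‖ = 1)
    (h𝒰 : ∀ f : X →L[ℝ] ℝ, ∀ᶠ x in (𝒰 : Filter X), f x = 0)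
    (hX : (kottmanConst X).toReal ≤ 1)
    (hE : ∀ R : ℝ, 1 < R → AltExits 𝒰 R Set.univ 1 0) (h : AltCoupled 𝒰 R σ v) :
    ∀ᶠ x in (𝒰 : Filter X), AltCoupled 𝒰 R (-σ) (v + σ • x) := by
  induction h with
  | root R R' d hR' hR h =>
    obtain ⟨R₁, hR₁, hR₁'⟩ := exists_between hR'
    filter_upwards [h.eventually, h𝒰1,
      (hE R₁ hR₁).eventually_exits_near h𝒰1 h𝒰 hX hR₁ hR₁'] with x hx hx1 hnear
    have hx' := hx (by simpa [hx1] using hR'.le)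
    have hc : AltCoupled 𝒰 R' (-1) x := .root R' R₁ x hR₁ hR₁' hnear
    have := AltCoupled.cons R R' 1 d x (by simpa using hx') hc
    simpa [sub_eq_add_neg] using this
  | cons R R' σ d w h hw ih =>
    filter_upwards [h.eventually, ih] with x hx hx'
    have h1 := hx (hx'.norm_le h𝒰)
    have := AltCoupled.cons R R' (-σ) d (w + -σ • x) h1 hx'
    convert this using 1
    simp only [neg_smul]
    abel

/-- Coupling persists under almost every draw and forces the norm bound, whereas `AltExits` is
well-founded and must end outside the ball. -/
theorem not_exits (h𝒰1 : ∀ᶠ x in (𝒰 : Filter X), ‖x‖ = 1)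
    (h𝒰 : ∀ f : X →L[ℝ] ℝ, ∀ᶠ x in (𝒰 : Filter X), f x = 0)
    (hX : (kottmanConst X).toReal ≤ 1)
    (hE : ∀ R : ℝ, 1 < R → AltExits 𝒰 R Set.univ 1 0) (h : AltCoupled 𝒰 R σ v) :
    ¬ AltExits 𝒰 R Set.univ σ v := by
  intro hexit
  induction hexit with
  | step σ v hv S hS _ hrec ih =>
    obtain ⟨x, hxS, hx⟩ := ((show ∀ᶠ x in (𝒰 : Filter X), x ∈ S from hS).and
      (h.eventually h𝒰1 h𝒰 hX hE)).exists
    exact ih x hxS (hx.norm_le h𝒰) hx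

end AltCoupled

theorem exists_not_altExits {𝒰 : Ultrafilter X} (h𝒰1 : ∀ᶠ x in (𝒰 : Filter X), ‖x‖ = 1)
    (h𝒰 : ∀ f : X →L[ℝ] ℝ, ∀ᶠ x in (𝒰 : Filter X), f x = 0)
    (hX : (kottmanConst X).toReal ≤ 1) :
    ∃ R : ℝ, 1 < R ∧ ¬ AltExits 𝒰 R Set.univ 1 0 := by
  by_contra! hE
  -- Any two radii `1 < R' < R` would do in place of 2 and 3.
  have h3 : (1 : ℝ) < 3 := by norm_num
  have h23 : (2 : ℝ) < 3 := by norm_num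
  obtain ⟨x, hx, hx1, hnear⟩ := ((hE 3 h3).eventually.and (h𝒰1.and
    ((hE 2 one_lt_two).eventually_exits_near h𝒰1 h𝒰 hX one_lt_two h23))).exists
  refine (AltCoupled.root 3 2 x one_lt_two h23 hnear).not_exits h𝒰1 h𝒰 hX hE ?_
  simpa using hx (by simp [hx1])

end

/-! ### Distortion of `c₀`, and the Kottman constant exceeds one -/

section

variable {X : Type*} [NormedAddCommGroup X]

/-- If a set absorbs almost all translates along a filter, then it contains all finite sums of
distinct terms of some sequence. -/
theorem exists_seq_forall_finset_sum_mem {𝒱 : Filter X} [𝒱.NeBot] {P : X → Prop}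
    (hP : ∀ᶠ u in 𝒱, P u) {G : Set X} (h0 : (0 : X) ∈ G)
    (hG : ∀ v ∈ G, ∀ᶠ u in 𝒱, v + u ∈ G) :
    ∃ u : ℕ → X, (∀ n, P (u n)) ∧ ∀ F : Finset ℕ, ∑ i ∈ F, u i ∈ G := by
  set T := {H : Set X // 0 ∈ H ∧ ∀ v ∈ H, ∀ᶠ u in 𝒱, v + u ∈ H} with hT
  have hex : ∀ H : T, ∃ u, P u ∧ u ∈ H.1 := fun H => by
    have := H.2.2 0 H.2.1
    simp only [zero_add] at this
    exact (hP.and this).exists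
  choose c hcP hcm using hex
  -- Shrinking `H` to the `v` with both `v` and `v + c H` in `H` preserves absorption and leaves the
  -- choice of adding `c H` open.
  set next : T → T := fun H => ⟨{v | v ∈ H.1 ∧ v + c H ∈ H.1},
    ⟨H.2.1, by simpa using hcm H⟩, fun v hv => by
      filter_upwards [H.2.2 v hv.1, H.2.2 _ hv.2] with u hu hu'
      exact ⟨hu, by rwa [add_right_comm]⟩⟩ with hnext
  set S : ℕ → T := fun n => next^[n] ⟨G, h0, hG⟩ with hS
  have hS' : ∀ n, S (n + 1) = next (S n) := fun n => Function.iterate_succ_apply' _ _ _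
  refine ⟨fun n => c (S n), fun n => hcP _, fun F => ?_⟩
  have key : ∀ n, ∀ v ∈ (S n).1, v + ∑ i ∈ F with i < n, c (S i) ∈ G := by
    intro n
    induction n with
    | zero => intro v hv; simpa using (show v ∈ G from hv)
    | succ n ih =>
      intro v hv
      rw [hS'] at hv
      by_cases hn : n ∈ F
      · have hF : ({i ∈ F | i < n + 1} : Finset ℕ) = insert n {i ∈ F | i < n} := by
          ext i; simp only [Finset.mem_filter, Finset.mem_insert]
          constructor
          · rintro ⟨h1, h2⟩; rcases Nat.lt_succ_iff_lt_or_eq.1 h2 with h | h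
            · exact .inr ⟨h1, h⟩
            · exact .inl h
          · rintro (rfl | ⟨h1, h2⟩)
            · exact ⟨hn, Nat.lt_succ_self _⟩
            · exact ⟨h1, h2.trans (Nat.lt_succ_self _)⟩
        rw [hF, Finset.sum_insert (by simp), ← add_assoc]
        exact ih _ hv.2
      · have hF : ({i ∈ F | i < n + 1} : Finset ℕ) = {i ∈ F | i < n} := by
          refine Finset.filter_congr fun i hi => ?_
          rw [Nat.lt_succ_iff_lt_or_eq, or_iff_left]
          rintro rfl; exact hn hi
        rw [hF]
        exact ih _ hv.1
  obtain ⟨n, hn⟩ : ∃ n, ∀ i ∈ F, i < n :=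
    ⟨F.sup id + 1, fun i hi => Nat.lt_succ_of_le (Finset.le_sup (f := id) hi)⟩
  have := key n 0 (S n).2.1
  rwa [zero_add, Finset.filter_true_of_mem hn] at this

variable [NormedSpace ℝ X]

/-- Apply a norming functional and split the indices by the sign of its value on `u i`; each half is
a plain subsum, whence the factor 2. -/
theorem norm_sum_smul_le_of_norm_sum_le {u : ℕ → X} {R : ℝ}
    (hu : ∀ F : Finset ℕ, ‖∑ i ∈ F, u i‖ ≤ R) (F : Finset ℕ) {a : ℕ → ℝ}
    (ha : ∀ i, |a i| ≤ 1) : ‖∑ i ∈ F, a i • u i‖ ≤ 2 * R := by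
  obtain ⟨f, hf, hfv⟩ := exists_dual_vector'' ℝ (∑ i ∈ F, a i • u i)
  have hf' : ∀ v, |f v| ≤ ‖v‖ := fun v =>
    (f.le_opNorm v).trans (mul_le_of_le_one_left (norm_nonneg _) hf)
  have hfv' : f (∑ i ∈ F, a i • u i) = ‖∑ i ∈ F, a i • u i‖ := hfv
  have h1 : f (∑ i ∈ F, a i • u i) ≤ ∑ i ∈ F, |f (u i)| := by
    rw [map_sum]
    refine Finset.sum_le_sum fun i _ => ?_
    rw [map_smul, smul_eq_mul]
    refine (le_abs_self _).trans ?_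
    rw [abs_mul]
    exact mul_le_of_le_one_left (abs_nonneg _) (ha i)
  have h2 : ∑ i ∈ F, |f (u i)| =
      f (∑ i ∈ F with 0 ≤ f (u i), u i) - f (∑ i ∈ F with ¬ 0 ≤ f (u i), u i) := by
    rw [map_sum, map_sum, ← Finset.sum_filter_add_sum_filter_not F (fun i => 0 ≤ f (u i)),
      sub_eq_add_neg, ← Finset.sum_neg_distrib]
    congr 1
    · exact Finset.sum_congr rfl fun i hi => abs_of_nonneg (Finset.mem_filter.1 hi).2
    · exact Finset.sum_congr rfl fun i hi =>
        abs_of_neg (not_le.1 (Finset.mem_filter.1 hi).2)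
  have h3 := (abs_le.1 (hf' (∑ i ∈ F with 0 ≤ f (u i), u i))).2
  have h4 := (abs_le.1 (hf' (∑ i ∈ F with ¬ 0 ≤ f (u i), u i))).1
  have h5 := hu {i ∈ F | 0 ≤ f (u i)}
  have h6 := hu {i ∈ F | ¬ 0 ≤ f (u i)}
  linarith

/-- The multiplier sums supported in `[n, ∞)`. -/
def tailSums (u : ℕ → X) (n : ℕ) : Set X :=
  {v | ∃ (F : Finset ℕ) (a : ℕ → ℝ), (∀ i ∈ F, n ≤ i) ∧ (∀ i, |a i| ≤ 1) ∧ v = ∑ i ∈ F, a i • u i}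

theorem tailSums_anti (u : ℕ → X) : Antitone (tailSums u) := by
  rintro m n hmn v ⟨F, a, hF, ha, rfl⟩
  exact ⟨F, a, fun i hi => hmn.trans (hF i hi), ha, rfl⟩

theorem neg_mem_tailSums {u : ℕ → X} {n : ℕ} {v : X} (hv : v ∈ tailSums u n) :
    -v ∈ tailSums u n := by
  obtain ⟨F, a, hF, ha, rfl⟩ := hv
  exact ⟨F, fun i => -a i, hF, fun i => by simpa using ha i, by simp⟩

theorem mem_tailSums_self (u : ℕ → X) (n : ℕ) : u n ∈ tailSums u n :=
  ⟨{n}, fun _ => 1, by simp, by simp, by simp⟩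

theorem exists_add_mem_tailSums {u : ℕ → X} {n : ℕ} {v : X} (hv : v ∈ tailSums u n) :
    ∃ m, n ≤ m ∧ ∀ w ∈ tailSums u m, v + w ∈ tailSums u n := by
  obtain ⟨F, a, hF, ha, rfl⟩ := hv
  refine ⟨max n (F.sup id + 1), le_max_left _ _, ?_⟩
  rintro w ⟨F', a', hF', ha', rfl⟩
  have hlt : ∀ i ∈ F, ∀ j ∈ F', i < j := fun i hi j hj =>
    (Nat.lt_succ_of_le (Finset.le_sup (f := id) hi)).trans_le
      ((le_max_right _ _).trans (hF' j hj))
  have hdisj : Disjoint F F' := Finset.disjoint_left.2 fun i hi hi' => (hlt i hi i hi').false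
  refine ⟨F ∪ F', fun i => if i ∈ F then a i else a' i, fun i hi => ?_, fun i => ?_, ?_⟩
  · rcases Finset.mem_union.1 hi with h | h
    · exact hF i h
    · exact (le_max_left _ _).trans (hF' i h)
  · show |if i ∈ F then a i else a' i| ≤ 1
    split_ifs
    · exact ha i
    · exact ha' i
  · rw [Finset.sum_union hdisj]
    congr 1
    · exact Finset.sum_congr rfl fun i hi => by simp [hi]
    · exact Finset.sum_congr rfl fun i hi => by simp [Finset.disjoint_right.1 hdisj hi]

/-- A sequence bounded away from zero whose finite subsums are bounded yields a sequence in a ball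
whose separation exceeds the radius by a fixed factor. -/
theorem one_lt_kottmanConst_of_norm_sum_le {u : ℕ → X} {R δ : ℝ} (hδ : 0 < δ)
    (huδ : ∀ n, δ ≤ ‖u n‖) (hu : ∀ F : Finset ℕ, ‖∑ i ∈ F, u i‖ ≤ R) :
    1 < (kottmanConst X).toReal := by
  set k : ℕ → ℝ := fun n => sSup (norm '' tailSums u n) with hk
  have hbdd : ∀ n, BddAbove (norm '' tailSums u n) := fun n => ⟨2 * R, by
    rintro _ ⟨v, ⟨F, a, -, ha, rfl⟩, rfl⟩
    exact norm_sum_smul_le_of_norm_sum_le hu F ha⟩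
  have hle : ∀ n, ∀ v ∈ tailSums u n, ‖v‖ ≤ k n := fun n v hv =>
    le_csSup (hbdd n) ⟨v, hv, rfl⟩
  have hne : ∀ n, (norm '' tailSums u n).Nonempty := fun n => ⟨_, _, mem_tailSums_self u n, rfl⟩
  have hδk : ∀ n, δ ≤ k n := fun n => (huδ n).trans (hle n _ (mem_tailSums_self u n))
  have hbelow : BddBelow (Set.range k) := ⟨δ, by rintro _ ⟨n, rfl⟩; exact hδk n⟩
  set K := ⨅ n, k n with hK
  have hKδ : δ ≤ K := le_ciInf hδk
  have hK0 : 0 < K := hδ.trans_le hKδ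
  -- Beyond `N` the tail suprema are within ten percent of their limit `K`, so successive blocks of
  -- norm above `9 / 10 * K` behave almost like the unit basis of `c₀`.
  obtain ⟨N, hN⟩ : ∃ N, k N < 11 / 10 * K := exists_lt_of_ciInf_lt (by linarith)
  have hbig : ∀ n, ∃ y ∈ tailSums u n, 9 / 10 * K < ‖y‖ := fun n => by
    have : 9 / 10 * K < k n := lt_of_lt_of_le (by linarith) (ciInf_le hbelow n)
    obtain ⟨_, ⟨y, hy, rfl⟩, hy'⟩ := exists_lt_of_lt_csSup (hne n) this
    exact ⟨y, hy, hy'⟩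
  choose y hy hyK using hbig
  choose m hm hadd using fun n => exists_add_mem_tailSums (hy n)
  set s : ℕ → ℕ := fun n => m^[n] N with hs
  have hs' : ∀ n, s (n + 1) = m (s n) := fun n => Function.iterate_succ_apply' _ _ _
  have hsm : Monotone s := monotone_nat_of_le_succ fun n => (hs' n).symm ▸ hm _
  set Y : ℕ → X := fun n => y (s n) with hY
  have hYadd : ∀ n, ∀ w ∈ tailSums u (s (n + 1)), Y n + w ∈ tailSums u (s n) := fun n w hw =>
    hadd _ w (hs' n ▸ hw)
  have hblock : ∀ d n, ∀ w ∈ tailSums u (s (n + d)),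
      ∑ i ∈ Finset.range d, Y (n + i) + w ∈ tailSums u (s n) := by
    intro d
    induction d with
    | zero => intro n w hw; simpa using hw
    | succ d ih =>
      intro n w hw
      rw [Finset.sum_range_succ, add_assoc]
      exact ih n _ (hYadd _ w hw)
  -- In `c₀` this is `(1, …, 1, -1, 0, …)`, a sequence of unit vectors at mutual distance 2.
  set z : ℕ → X := fun n => ∑ i ∈ Finset.range n, Y i - Y n with hz
  have hzN : ∀ n, ‖z n‖ ≤ 11 / 10 * K := fun n => by
    have := hblock n 0 (-Y n) (neg_mem_tailSums (by simpa using hy (s n)))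
    simp only [zero_add, ← sub_eq_add_neg] at this
    exact (hle _ _ this).trans hN.le
  have hsep : ∀ a b, a < b → 8 / 5 * K ≤ ‖z a - z b‖ := fun a b hab => by
    obtain ⟨d, rfl⟩ := Nat.exists_eq_add_of_le (Nat.succ_le_of_lt hab)
    set w := ∑ i ∈ Finset.range d, Y (a + 1 + i) + -Y (a + 1 + d) with hw
    have hwm : w ∈ tailSums u (s (a + 1)) := hblock d (a + 1) _ (neg_mem_tailSums (hy _))
    -- Since `Y a - w` is again a multiplier sum, `2 • Y a + w = 3 • Y a - (Y a - w)` has norm at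
    -- least `(27 / 10 - 11 / 10) * K`, against the radius `11 / 10 * K`.
    have hzz : z (a.succ + d) - z a = (3 : ℝ) • Y a - (Y a + -w) := by
      simp only [hz, hw, Nat.succ_eq_add_one, Finset.sum_range_add, Finset.sum_range_succ]
      module
    have h1 : ‖Y a + -w‖ ≤ 11 / 10 * K :=
      (hle N _ (tailSums_anti u (hsm (Nat.zero_le a)) (hYadd a _ (neg_mem_tailSums hwm)))).trans
        hN.le
    have h2 := norm_sub_norm_le ((3 : ℝ) • Y a) (Y a + -w)
    rw [norm_smul, Real.norm_of_nonneg zero_le_three] at h2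
    have h3 : 9 / 10 * K < ‖Y a‖ := hyK _
    rw [norm_sub_rev, hzz]
    linarith
  have := le_kottmanConst_mul (by positivity) z hzN hsep
  by_contra hcon
  nlinarith

end

/-- The Elton-Odell theorem: the Kottman constant of an infinite-dimensional normed space is
larger than one. -/
theorem one_lt_kottmanConst {X : Type*} [NormedAddCommGroup X] [NormedSpace ℝ X]
    (hX : ¬ FiniteDimensional ℝ X) : 1 < (kottmanConst X).toReal := by
  by_contra! hκ
  obtain ⟨𝒰, h𝒰1, h𝒰⟩ := exists_ultrafilter_norm_eq_one_forall_dual hX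
  obtain ⟨R, hR, hstay⟩ := exists_not_altExits h𝒰1 h𝒰 hκ
  have hstep : ∀ σ v, ‖v‖ ≤ R → ¬ AltExits 𝒰 R Set.univ σ v → ∀ᶠ x in (𝒰 : Filter X),
      ‖v + σ • x‖ ≤ R ∧ ¬ AltExits 𝒰 R Set.univ (-σ) (v + σ • x) := by
    -- The target is the whole space, so only the recursive condition can fail; the ultrafilter
    -- turns failure on a non-negligible set into failure almost everywhere.
    intro σ v hv h
    have h' : ¬ ∀ᶠ x in (𝒰 : Filter X), ‖v + σ • x‖ ≤ R →
        AltExits 𝒰 R Set.univ (-σ) (v + σ • x) := fun hS =>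
      h (.step σ v hv _ hS (fun _ _ _ => Set.mem_univ _) fun x hx => hx)
    rw [← Ultrafilter.eventually_not] at h'
    filter_upwards [h'] with x hx
    exact Classical.not_imp.1 hx
  -- Two consecutive draws are grouped into `x - y`, after which the sign is again `1`.
  have hG : ∀ v ∈ {v | ‖v‖ ≤ R ∧ ¬ AltExits 𝒰 R Set.univ 1 v}, ∀ᶠ u in
      (𝒰 : Filter X).bind (fun x => (𝒰 : Filter X).map fun y => x - y),
      v + u ∈ {v | ‖v‖ ≤ R ∧ ¬ AltExits 𝒰 R Set.univ 1 v} := by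
    rintro v ⟨hv, hv'⟩
    rw [Filter.eventually_bind]
    filter_upwards [hstep 1 v hv hv'] with x hx
    rw [Filter.eventually_map]
    filter_upwards [hstep _ _ hx.1 hx.2] with y hy
    have he : v + (x - y) = v + (1 : ℝ) • x + (-1 : ℝ) • y := by module
    rw [he]
    simpa using hy
  have hP : ∀ᶠ u in (𝒰 : Filter X).bind (fun x => (𝒰 : Filter X).map fun y => x - y),
      1 ≤ ‖u‖ := by
    rw [Filter.eventually_bind]
    filter_upwards [h𝒰1] with x hx
    rw [Filter.eventually_map]
    -- A functional norming `x` vanishes at almost every `y`, so `x - y` has norm at least 1.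
    obtain ⟨f, hf, hfx⟩ := exists_dual_vector'' ℝ x
    filter_upwards [h𝒰 f] with y hy
    have hfx' : f (x - y) = 1 := by rw [map_sub, hy, sub_zero, hfx, hx]; rfl
    calc (1 : ℝ) = ‖f (x - y)‖ := by rw [hfx', norm_one]
      _ ≤ ‖f‖ * ‖x - y‖ := f.le_opNorm _
      _ ≤ ‖x - y‖ := mul_le_of_le_one_left (norm_nonneg _) hf
  have : ((𝒰 : Filter X).bind fun x => (𝒰 : Filter X).map fun y => x - y).NeBot := by
    refine neBot_iff.2 fun hbot => ?_
    have hF := eventually_bot (α := X) (p := fun _ => False)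
    rw [← hbot, Filter.eventually_bind] at hF
    obtain ⟨x, hx⟩ := hF.exists
    rw [Filter.eventually_map] at hx
    exact hx.exists.choose_spec
  obtain ⟨u, hu1, hu⟩ := exists_seq_forall_finset_sum_mem hP
    (show (0 : X) ∈ {v | ‖v‖ ≤ R ∧ ¬ AltExits 𝒰 R Set.univ 1 v} from
      ⟨by rw [norm_zero]; linarith, hstay⟩) hG
  exact hκ.not_gt (one_lt_kottmanConst_of_norm_sum_le one_pos hu1 fun F => (hu F).1)

/-! ### Hölder extension of real-valued functions -/

section

variable {X : Type*} [NormedAddCommGroup X]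

theorem norm_sub_rpow_le_add {α : ℝ} (hα0 : 0 ≤ α) (hα1 : α ≤ 1) (a b c : X) :
    ‖a - c‖ ^ α ≤ ‖a - b‖ ^ α + ‖b - c‖ ^ α := by
  have h := NNReal.rpow_add_le_add_rpow ‖a - b‖₊ ‖b - c‖₊ hα0 hα1
  have h' : (‖a - b‖ + ‖b - c‖) ^ α ≤ ‖a - b‖ ^ α + ‖b - c‖ ^ α := by exact_mod_cast h
  exact (Real.rpow_le_rpow (norm_nonneg _) (norm_sub_le_norm_sub_add_norm_sub a b c) hα0).trans h'

/-- The largest Hölder extension of a real-valued function. -/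
theorem exists_holder_extension_ge {α : ℝ} (hα0 : 0 < α) (hα1 : α ≤ 1) {M : Set X} [Nonempty M]
    {g : M → ℝ} {C : ℝ} (hC : 0 ≤ C) (hg : ∀ y y' : M, g y ≤ g y' + C * ‖(y : X) - y'‖ ^ α) :
    ∃ U : X → ℝ, (∀ y : M, U y = g y) ∧ (∀ x x', U x ≤ U x' + C * ‖x - x'‖ ^ α) ∧
      ∀ (x : X) (b : ℝ), (∀ y : M, b ≤ g y + C * ‖x - y‖ ^ α) → b ≤ U x := by
  have htri : ∀ a b c : X, C * ‖a - c‖ ^ α ≤ C * ‖a - b‖ ^ α + C * ‖b - c‖ ^ α := fun a b c => by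
    rw [← mul_add]
    exact mul_le_mul_of_nonneg_left (norm_sub_rpow_le_add hα0.le hα1 a b c) hC
  have hbdd : ∀ x : X, BddBelow (Set.range fun y : M => g y + C * ‖x - y‖ ^ α) := fun x => by
    obtain ⟨y₀⟩ := ‹Nonempty M›
    refine ⟨g y₀ - C * ‖(y₀ : X) - x‖ ^ α, ?_⟩
    rintro _ ⟨y, rfl⟩
    have := htri y₀ x y
    have := hg y₀ y
    dsimp only
    linarith
  -- McShane's formula; the last clause records that the infimum is the greatest lower bound of the
  -- cones.
  refine ⟨fun x => ⨅ y : M, (g y + C * ‖x - y‖ ^ α), fun y => le_antisymm ?_ ?_, fun x x' => ?_,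
    fun x b hb => le_ciInf hb⟩
  · refine (ciInf_le (hbdd y) y).trans ?_
    simp [Real.zero_rpow hα0.ne']
  · exact le_ciInf fun y' => hg y y'
  · rw [← sub_le_iff_le_add]
    refine le_ciInf fun y => ?_
    have := ciInf_le (hbdd x) y
    have := htri x x' y
    linarith

/-- A Hölder extension of a real-valued function that is as close to zero as possible. -/
theorem exists_holder_extension_abs_le {α : ℝ} (hα0 : 0 < α) (hα1 : α ≤ 1) {M : Set X}
    [Nonempty M] {g : M → ℝ} {C : ℝ} (hC : 0 ≤ C)
    (hg : ∀ y y' : M, |g y - g y'| ≤ C * ‖(y : X) - y'‖ ^ α) :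
    ∃ F : X → ℝ, (∀ y : M, F y = g y) ∧ (∀ x x', |F x - F x'| ≤ C * ‖x - x'‖ ^ α) ∧
      ∀ (x : X) (b : ℝ), 0 ≤ b → (∀ y : M, |g y| ≤ C * ‖x - y‖ ^ α + b) → |F x| ≤ b := by
  obtain ⟨U, hUg, hU, hUb⟩ := exists_holder_extension_ge hα0 hα1 hC (g := g) fun y y' => by
    linarith [(abs_le.1 (hg y y')).2]
  obtain ⟨V, hVg, hV, hVb⟩ := exists_holder_extension_ge hα0 hα1 hC (g := fun y => -g y)
    fun y y' => by linarith [(abs_le.1 (hg y y')).1]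
  have hle : ∀ x x', max (-V x) (min 0 (U x)) ≤
      max (-V x') (min 0 (U x')) + C * ‖x - x'‖ ^ α := fun x x' => by
    have hnn : 0 ≤ C * ‖x - x'‖ ^ α := by positivity
    refine max_le ?_ ?_
    · have := hV x' x
      rw [norm_sub_rev] at this
      linarith [le_max_left (-V x') (min 0 (U x'))]
    · refine le_trans ?_ (add_le_add_left (le_max_right _ _) _)
      rcases le_total 0 (U x') with h | h
      · rw [min_eq_left h]
        linarith [min_le_left 0 (U x)]
      · rw [min_eq_right h]
        exact (min_le_right _ _).trans (hU x x')
  -- This is zero clamped between the smallest extension `-V` and the largest extension `U`.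
  refine ⟨fun x => max (-V x) (min 0 (U x)), fun y => ?_, fun x x' => ?_, fun x b hb h => ?_⟩
  · simp [hUg, hVg]
  · rw [abs_sub_le_iff]
    have h1 := hle x x'
    have h2 := hle x' x
    rw [norm_sub_rev] at h2
    constructor <;> linarith
  · have h1 : -b ≤ U x := hUb x _ fun y => by linarith [(abs_le.1 (h y)).1]
    have h2 : -b ≤ V x := hVb x _ fun y => by linarith [(abs_le.1 (h y)).2]
    exact abs_le.2 ⟨(le_min (by linarith) h1).trans (le_max_right _ _),
      max_le (by linarith) ((min_le_left _ _).trans hb)⟩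

/-- A pointwise null sequence of uniformly Hölder functions is eventually dominated by the cone
with slope `κ ^ α` times its Hölder constant, up to `ε`. -/
theorem eventually_le_kottmanConst_rpow_mul [NormedSpace ℝ X]
    (hκ : 1 < (kottmanConst X).toReal) {α : ℝ} (hα0 : 0 < α) (hα1 : α ≤ 1) {M : Set X}
    [hM : Nonempty M] {g : ℕ → M → ℝ} {L : ℝ} (hL : 0 ≤ L)
    (hg0 : ∀ y, Tendsto (fun n => g n y) atTop (𝓝 0))
    (hg : ∀ n (y y' : M), g n y ≤ g n y' + L * ‖(y : X) - y'‖ ^ α) (x : X) {ε : ℝ} (hε : 0 < ε) :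
    ∀ᶠ n in atTop, ∀ y : M,
      g n y ≤ (kottmanConst X).toReal ^ α * L * ‖x - y‖ ^ α + ε := by
  obtain ⟨y₀⟩ := id hM
  rcases hL.eq_or_lt with rfl | hL
  · filter_upwards [(hg0 y₀).eventually (gt_mem_nhds hε)] with n hn y
    have := hg n y y₀
    simp only [zero_mul, mul_zero, add_zero, zero_add] at this ⊢
    linarith
  set κ := (kottmanConst X).toReal with hκ_def
  have hκ0 : 0 < κ := one_pos.trans hκ
  have hκα : 1 < κ ^ α := Real.one_lt_rpow hκ hα0
  by_contra hcon
  rw [not_eventually] at hcon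
  simp only [not_forall, not_le] at hcon
  have : (atTop ⊓ 𝓟 {n | ∃ y : M, κ ^ α * L * ‖x - y‖ ^ α + ε < g n y}).NeBot :=
    frequently_mem_iff_neBot.1 hcon
  set 𝒲 := Ultrafilter.of (atTop ⊓ 𝓟 {n | ∃ y : M, κ ^ α * L * ‖x - y‖ ^ α + ε < g n y}) with h𝒲
  have h𝒲le : (𝒲 : Filter ℕ) ≤ atTop := (Ultrafilter.of_le _).trans inf_le_left
  have hex : ∀ n, ∃ y : M, (∃ y : M, κ ^ α * L * ‖x - y‖ ^ α + ε < g n y) →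
      κ ^ α * L * ‖x - y‖ ^ α + ε < g n y := fun n => by
    by_cases h : ∃ y : M, κ ^ α * L * ‖x - y‖ ^ α + ε < g n y
    · exact ⟨h.choose, fun _ => h.choose_spec⟩
    · exact ⟨y₀, fun h' => absurd h' h⟩
  choose y hy using hex
  have hbig : ∀ᶠ n in (𝒲 : Filter ℕ), κ ^ α * L * ‖x - y n‖ ^ α + ε < g n (y n) := by
    filter_upwards [(Ultrafilter.of_le _).trans inf_le_right (mem_principal_self _)] with n hn
    exact hy n hn
  -- Comparing the violated inequality at `y n` with the slope-`L` bound from `y₀` leaves the factor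
  -- `κ ^ α - 1`; here `κ > 1` is essential.
  set B := ((1 + L * ‖x - y₀‖ ^ α) / ((κ ^ α - 1) * L)) ^ α⁻¹ with hB
  have hden : 0 < (κ ^ α - 1) * L := mul_pos (by linarith) hL
  have hbdd : ∀ᶠ n in (𝒲 : Filter ℕ), ‖x - y n‖ ∈ Set.Icc 0 B := by
    filter_upwards [hbig, h𝒲le ((hg0 y₀).eventually (gt_mem_nhds one_pos))] with n hn hn1
    refine ⟨norm_nonneg _, ?_⟩
    rw [hB, Real.le_rpow_inv_iff_of_pos (norm_nonneg _) (by positivity) hα0, le_div_iff₀ hden]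
    have h1 := hg n (y n) y₀
    have h2 := mul_le_mul_of_nonneg_left
      (norm_sub_rpow_le_add hα0.le hα1 (y n : X) x (y₀ : X)) hL.le
    rw [norm_sub_rev (y n : X) x] at h2
    have hn1' : g n y₀ < 1 := hn1
    nlinarith
  obtain ⟨ρ, hρ, hlim⟩ := isCompact_Icc.ultrafilter_le_nhds (𝒲.map fun n => ‖x - y n‖)
    (le_principal_iff.2 hbdd)
  have hlim : Tendsto (fun n => ‖x - y n‖) 𝒲 (𝓝 ρ) := hlim
  have hcont : ContinuousAt (fun t : ℝ => κ ^ α * t ^ α) ρ :=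
    continuousAt_const.mul (Real.continuousAt_rpow_const ρ α (.inr hα0.le))
  have hεL : 0 < ε / L := div_pos hε hL
  -- Of the excess `ε / L`, one quarter is lost to the convergence of `‖x - y n‖` and one quarter to
  -- `g n (y k)`; the remaining half leaves room for a radius `r > ρ`.
  set T := κ ^ α * ρ ^ α + ε / L / 2 with hT
  obtain ⟨r, hr, hrT⟩ : ∃ r, ρ < r ∧ κ ^ α * r ^ α < T := by
    have h1 : ∀ᶠ t in 𝓝[>] ρ, κ ^ α * t ^ α < T :=
      (hcont.eventually (gt_mem_nhds (by linarith))).filter_mono nhdsWithin_le_nhds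
    obtain ⟨r, h, h'⟩ := (h1.and self_mem_nhdsWithin).exists
    exact ⟨r, h', h⟩
  have hr0 : 0 < r := hρ.1.trans_lt hr
  have hT0 : 0 ≤ T := le_trans (by positivity) hrT.le
  have hlow : ∀ᶠ n in (𝒲 : Filter ℕ), κ ^ α * ρ ^ α - ε / L / 4 < κ ^ α * ‖x - y n‖ ^ α :=
    (hcont.tendsto.comp hlim).eventually (lt_mem_nhds (by linarith))
  have hsep : ∀ᶠ k in (𝒲 : Filter ℕ), ∀ᶠ n in (𝒲 : Filter ℕ), T ≤ ‖(y k : X) - y n‖ ^ α := by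
    refine Eventually.of_forall fun k => ?_
    filter_upwards [hbig, hlow, h𝒲le ((hg0 (y k)).eventually
      (gt_mem_nhds (show 0 < ε / 4 by linarith)))] with n hn hn' hn0
    have h1 := hg n (y n) (y k)
    rw [norm_sub_rev] at h1
    have hn0' : g n (y k) < ε / 4 := hn0
    have h2 : L * T ≤ L * ‖(y k : X) - y n‖ ^ α := by
      have h3 := mul_lt_mul_of_pos_left hn' hL
      have h4 : L * (ε / L) = ε := mul_div_cancel₀ ε hL.ne'
      rw [hT]
      nlinarith
    exact le_of_mul_le_mul_left h2 hL
  obtain ⟨n, hn, hn'⟩ := Filter.exists_seq_of_eventually_eventually (𝒲 : Filter ℕ)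
    (P := fun n => ‖x - y n‖ < r) (hlim.eventually (gt_mem_nhds hr)) hsep
  have hfinal := le_kottmanConst_mul (t := T ^ α⁻¹) hr0 (fun k => x - (y (n k) : X))
    (fun k => (hn k).le) fun i j hij => by
      rw [sub_sub_sub_cancel_left, norm_sub_rev,
        Real.rpow_inv_le_iff_of_pos hT0 (norm_nonneg _) hα0]
      exact hn' i j hij
  rw [Real.rpow_inv_le_iff_of_pos hT0 (by positivity) hα0, Real.mul_rpow hκ0.le hr0.le] at hfinal
  exact absurd hfinal hrT.not_ge

end

/-! ### Hölder maps into `c₀` -/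

theorem holderWith_iff_dist_le {X Y : Type*} [PseudoMetricSpace X] [PseudoMetricSpace Y]
    {C r : ℝ≥0} {f : X → Y} :
    HolderWith C r f ↔ ∀ x y, dist (f x) (f y) ≤ C * dist x y ^ (r : ℝ) := by
  refine ⟨fun h x y => h.dist_le x y, fun h x y => ?_⟩
  have := h x y
  rw [← coe_nndist, ← coe_nndist, ← NNReal.coe_rpow, ← NNReal.coe_mul, NNReal.coe_le_coe] at this
  rw [edist_nndist, edist_nndist, ← ENNReal.coe_rpow_of_nonneg (nndist x y) r.coe_nonneg,
    ← ENNReal.coe_mul]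
  exact ENNReal.coe_le_coe.2 this

namespace SeqC0

theorem dist_le_iff {f g : SeqC0} {C : ℝ} (hC : 0 ≤ C) :
    dist f g ≤ C ↔ ∀ n, |f n - g n| ≤ C := by
  rw [← ZeroAtInftyContinuousMap.dist_toBCF_eq_dist, BoundedContinuousFunction.dist_le hC]
  rfl

theorem abs_sub_le_dist (f g : SeqC0) (n : ℕ) : |f n - g n| ≤ dist f g :=
  (dist_le_iff dist_nonneg).1 le_rfl n

theorem tendsto_zero (f : SeqC0) : Tendsto (fun n => f n) atTop (𝓝 0) := by
  have := f.zero_at_infty'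
  rwa [cocompact_eq_cofinite, Nat.cofinite_eq_atTop] at this

/-- The null sequence with given terms. -/
def ofTendsto (a : ℕ → ℝ) (ha : Tendsto a atTop (𝓝 0)) : SeqC0 where
  toFun := a
  continuous_toFun := continuous_of_discreteTopology
  zero_at_infty' := by rwa [cocompact_eq_cofinite, Nat.cofinite_eq_atTop]

/-- The sequence whose only nonzero term is `c`, at position `n`. -/
def single (n : ℕ) (c : ℝ) : SeqC0 :=
  ofTendsto (Pi.single n c) <| tendsto_const_nhds.congr' <| by
    filter_upwards [eventually_gt_atTop n] with m hm
    rw [Pi.single_eq_of_ne hm.ne']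

theorem dist_single_le (n m : ℕ) {c : ℝ} (hc : 0 ≤ c) : dist (single n c) (single m c) ≤ c := by
  refine (dist_le_iff hc).2 fun k => ?_
  show |(Pi.single n c : ℕ → ℝ) k - (Pi.single m c : ℕ → ℝ) k| ≤ c
  rw [Pi.single_apply, Pi.single_apply]
  split_ifs <;> simp [abs_of_nonneg hc, hc]

end SeqC0

section

variable {X : Type*} [NormedAddCommGroup X] [NormedSpace ℝ X]

/-- Coordinatewise clamped extensions work: the cone estimate applied to `f` and to `-f` bounds the
`n`-th extension at `x` by `ε / 2` for large `n`, so the values lie in `c₀`. -/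
theorem isHolderExtensionBound_kottmanConst_rpow (hκ : 1 < (kottmanConst X).toReal) {α : ℝ≥0}
    (hα0 : 0 < α) (hα1 : α ≤ 1) :
    IsHolderExtensionBound α X SeqC0 ((kottmanConst X).toNNReal ^ (α : ℝ)) := by
  have hα0' : (0 : ℝ) < α := hα0
  have hα1' : (α : ℝ) ≤ 1 := hα1
  have hκ' : 1 < (kottmanConst X).toNNReal := hκ
  refine ⟨NNReal.rpow_pos (one_pos.trans hκ'), fun M f hf => ?_⟩
  rcases isEmpty_or_nonempty M with hM | hM
  · exact ⟨0, fun x => hM.elim x, by simp⟩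
  set L := nnHolderNorm α f with hL
  have hfL : ∀ y y' : M, dist (f y) (f y') ≤ L * ‖(y : X) - y'‖ ^ (α : ℝ) := fun y y' => by
    rw [← dist_eq_norm]; exact hf.holderWith.dist_le y y'
  set κ := (kottmanConst X).toReal with hκ_def
  have hκα : 1 ≤ κ ^ (α : ℝ) := (Real.one_lt_rpow hκ hα0').le
  have hcoord : ∀ n (y y' : M), |f y n - f y' n| ≤ L * ‖(y : X) - y'‖ ^ (α : ℝ) := fun n y y' =>
    (SeqC0.abs_sub_le_dist _ _ n).trans (hfL y y')
  have hC0 : 0 ≤ κ ^ (α : ℝ) * L := by positivity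
  have hext := fun n => exists_holder_extension_abs_le hα0' hα1' hC0 (g := fun y : M => f y n)
    fun y y' => (hcoord n y y').trans <| mul_le_mul_of_nonneg_right
      (le_mul_of_one_le_left L.coe_nonneg hκα) (by positivity)
  choose F hFf hF hFb using hext
  have hF0 : ∀ x, Tendsto (fun n => F n x) atTop (𝓝 0) := fun x => by
    rw [Metric.tendsto_nhds]
    intro ε hε
    have h1 := eventually_le_kottmanConst_rpow_mul hκ hα0' hα1' (g := fun n (y : M) => f y n) L.coe_nonneg
      (fun y => (f y).tendsto_zero) (fun n y y' => by linarith [(abs_le.1 (hcoord n y y')).2]) x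
      (half_pos hε)
    have h2 := eventually_le_kottmanConst_rpow_mul hκ hα0' hα1' (g := fun n (y : M) => -f y n) L.coe_nonneg
      (fun y => by simpa using (f y).tendsto_zero.neg)
      (fun n y y' => by linarith [(abs_le.1 (hcoord n y y')).1]) x (half_pos hε)
    filter_upwards [h1, h2] with n hn1 hn2
    rw [dist_zero_right, Real.norm_eq_abs]
    refine (hFb n x (ε / 2) (half_pos hε).le fun y => ?_).trans_lt (half_lt_self hε)
    exact abs_le'.2 ⟨hn1 y, hn2 y⟩
  refine ⟨fun x => SeqC0.ofTendsto _ (hF0 x), fun y => ?_, ?_⟩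
  · ext n; exact hFf n y
  · rw [← hf.coe_nnHolderNorm_eq_eHolderNorm, ← ENNReal.coe_mul]
    refine HolderWith.eHolderNorm_le (holderWith_iff_dist_le.2 fun x x' => ?_)
    rw [dist_eq_norm x x']
    exact (SeqC0.dist_le_iff (by positivity)).2 fun n => hF n x x'

theorem kottmanConst_rpow_le_of_isHolderExtensionBound {X : Type*} [NormedAddCommGroup X] {α : ℝ≥0} (hα0 : 0 < α) {l : ℝ≥0}
    (hl : IsHolderExtensionBound α X SeqC0 l) : kottmanConst X ^ (α : ℝ) ≤ l := by
  have hα0' : (0 : ℝ) < α := hα0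
  rw [← ENNReal.le_rpow_inv_iff hα0']
  refine iSup₂_le fun x hx => ?_
  rw [ENNReal.le_rpow_inv_iff hα0']
  rcases eq_or_ne (seqSep x) 0 with h0 | h0
  · rw [h0, ENNReal.zero_rpow_of_pos hα0']; exact zero_le
  have htop : seqSep x ≠ ∞ := ne_top_of_le_ne_top (kottmanConst_ne_top X)
    (le_iSup₂ (f := fun (x : ℕ → X) (_ : ∀ n, ‖x n‖ ≤ 1) => seqSep x) x hx)
  set s := (seqSep x).toReal with hs
  have hs0 : 0 < s := ENNReal.toReal_pos h0 htop
  have hsep : ∀ n m, n ≠ m → s ≤ ‖x n - x m‖ := fun n m hnm => by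
    have h1 : seqSep x ≤ ‖x n - x m‖ₑ := iInf_le_of_le n (iInf_le_of_le m (iInf_le _ hnm))
    rw [← ofReal_norm] at h1
    exact ENNReal.toReal_le_of_le_ofReal (norm_nonneg _) h1
  have hinj : Function.Injective x := fun n m hnm => by
    by_contra hne
    have := hsep n m hne
    rw [hnm, sub_self, norm_zero] at this
    linarith
  set c := s ^ (α : ℝ) with hc
  have hc0 : 0 ≤ c := by positivity
  set f : Set.range x → SeqC0 := fun y => SeqC0.single (Function.invFun x y) c with hf
  have hfH : HolderWith 1 α f := holderWith_iff_dist_le.2 fun y y' => by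
    obtain ⟨_, n, rfl⟩ := y
    obtain ⟨_, m, rfl⟩ := y'
    rcases eq_or_ne n m with rfl | hnm
    · simp only [dist_self]; positivity
    · refine (SeqC0.dist_single_le _ _ hc0).trans ?_
      rw [NNReal.coe_one, one_mul, Subtype.dist_eq, dist_eq_norm]
      exact Real.rpow_le_rpow hs0.le (hsep n m hnm) hα0'.le
  obtain ⟨F, hFf, hF⟩ := hl.2 _ f hfH.memHolder
  have hFl : eHolderNorm α F ≤ l := hF.trans <| by
    refine (mul_le_mul_right hfH.eHolderNorm_le _).trans ?_
    simp
  have hFm : MemHolder α F := eHolderNorm_lt_top.1 (hFl.trans_lt ENNReal.coe_lt_top)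
  have hFl' : nnHolderNorm α F ≤ l := by
    rwa [← hFm.coe_nnHolderNorm_eq_eHolderNorm, ENNReal.coe_le_coe] at hFl
  -- Evaluation at the centre `0` of the ball, at distance at most 1 from every `x n`; letting `n →
  -- ∞` then removes `F 0 n`.
  have hbound : ∀ n, c - F 0 n ≤ l := fun n => by
    have h1 : F (x n) n = c := by
      rw [hFf ⟨x n, n, rfl⟩]
      show (Pi.single (Function.invFun x (x n)) c : ℕ → ℝ) n = c
      rw [Function.leftInverse_invFun hinj n, Pi.single_eq_same]
    have h2 := (SeqC0.abs_sub_le_dist (F (x n)) (F 0) n).trans (hFm.holderWith.dist_le (x n) 0)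
    rw [dist_zero_right, h1] at h2
    have h3 : ‖x n‖ ^ (α : ℝ) ≤ 1 := Real.rpow_le_one (norm_nonneg _) (hx n) hα0'.le
    calc c - F 0 n ≤ nnHolderNorm α F * ‖x n‖ ^ (α : ℝ) := (le_abs_self _).trans h2
      _ ≤ nnHolderNorm α F := mul_le_of_le_one_right (NNReal.coe_nonneg _) h3
      _ ≤ l := hFl'
  have hcl : c ≤ l := by
    have := (tendsto_const_nhds (x := c)).sub (F 0).tendsto_zero
    rw [sub_zero] at this
    exact le_of_tendsto this (Eventually.of_forall hbound)
  rw [← ENNReal.ofReal_toReal htop, ENNReal.ofReal_rpow_of_pos hs0]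
  exact (ENNReal.ofReal_le_ofReal hcl).trans (ENNReal.ofReal_coe_nnreal).le

end

theorem mainTheorem1 {X : Type*} [NormedAddCommGroup X] [NormedSpace ℝ X] [CompleteSpace X]
    (hX : ¬ FiniteDimensional ℝ X) (α : ℝ≥0) (hα0 : 0 < α) (hα1 : α ≤ 1) :
    holderExtensionConst α X SeqC0 = kottmanConst X ^ (α : ℝ) ∧
      ∃ l : ℝ≥0, IsHolderExtensionBound α X SeqC0 l ∧
        (l : ℝ≥0∞) = holderExtensionConst α X SeqC0 := by
  have hb := isHolderExtensionBound_kottmanConst_rpow (one_lt_kottmanConst hX) hα0 hα1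
  have hcoe : (((kottmanConst X).toNNReal ^ (α : ℝ) : ℝ≥0) : ℝ≥0∞) = kottmanConst X ^ (α : ℝ) := by
    rw [ENNReal.coe_rpow_of_nonneg _ α.coe_nonneg, ENNReal.coe_toNNReal (kottmanConst_ne_top X)]
  have heq : holderExtensionConst α X SeqC0 = kottmanConst X ^ (α : ℝ) := by
    refine le_antisymm ?_ (le_iInf₂ fun l hl =>
      kottmanConst_rpow_le_of_isHolderExtensionBound hα0 hl)
    rw [← hcoe]
    exact iInf₂_le _ hb
  exact ⟨heq, _, hb, hcoe.trans heq.symm⟩
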